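/- Let $\mathbb{C}_\infty=\mathbb{C}\cup\{\infty\}$ be the Riemann sphere with the spherical metric. A continuum is a nonempty compact connected metric space; it is indecomposable if it is not the union of two of its proper subcontinua. Let $X\subset\mathbb{C}_\infty$ be an indecomposable continuum. Then there is a sequence $(U_n)_{n=1}^\infty$ of (not necessarily distinct) complementary domains of $X$, i.e. connected components of $\mathbb{C}_\infty\setminus X$, such that $\lim_{n\to\infty}\partial U_n=X$ in the Hausdorff metric, where $\partial U_n$ is the boundary of $U_n$ in $\mathbb{C}_\infty$. -/

import Mathlib

open Set Filter Topology

noncomputable section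

namespace RiemannSphere

/-- The inverse stereographic projection from the Riemann sphere `ℂ ∪ {∞}` onto the unit sphere of
Euclidean three-space; the point `∞` goes to the north pole. -/
def toSphere : OnePoint ℂ → EuclideanSpace ℝ (Fin 3)
  | none => !₂[0, 0, 1]
  | some z => !₂[2 * z.re / (1 + ‖z‖ ^ 2), 2 * z.im / (1 + ‖z‖ ^ 2),
      1 - 2 / (1 + ‖z‖ ^ 2)]

theorem toSphere_infty : toSphere OnePoint.infty = !₂[0, 0, 1] := rfl

theorem toSphere_coe (z : ℂ) : toSphere (z : OnePoint ℂ) =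
    !₂[2 * z.re / (1 + ‖z‖ ^ 2), 2 * z.im / (1 + ‖z‖ ^ 2), 1 - 2 / (1 + ‖z‖ ^ 2)] := rfl

theorem norm_toSphere (p : OnePoint ℂ) : ‖toSphere p‖ = 1 := by
  induction p using OnePoint.rec with
  | infty => simp [toSphere_infty, EuclideanSpace.norm_eq, Fin.sum_univ_three]
  | coe z =>
    have h : (1 + ‖z‖ ^ 2) ≠ 0 := by positivity
    have hz : ‖z‖ ^ 2 = z.re * z.re + z.im * z.im := by
      rw [Complex.sq_norm, Complex.normSq_apply]
    rw [EuclideanSpace.norm_eq, Real.sqrt_eq_one, toSphere_coe]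
    simp only [Fin.sum_univ_three, Real.norm_eq_abs, sq_abs, Matrix.cons_val_zero,
      Matrix.cons_val_one, Matrix.cons_val]
    rw [hz] at h ⊢
    field_simp
    ring

theorem toSphere_ne_zero (p : OnePoint ℂ) : toSphere p ≠ 0 := by
  intro h
  have := norm_toSphere p
  simp [h] at this

theorem toSphere_injective : Function.Injective toSphere := by
  intro p q hpq
  induction p using OnePoint.rec with
  | infty =>
    induction q using OnePoint.rec with
    | infty => rfl
    | coe w =>
      have h2 := congrArg (fun v : EuclideanSpace ℝ (Fin 3) => v 2) hpq
      have hw : 0 < 2 / (1 + ‖w‖ ^ 2) := by positivity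
      simp only [toSphere_infty, toSphere_coe, Matrix.cons_val] at h2
      linarith
  | coe z =>
    induction q using OnePoint.rec with
    | infty =>
      have h2 := congrArg (fun v : EuclideanSpace ℝ (Fin 3) => v 2) hpq
      have hz : 0 < 2 / (1 + ‖z‖ ^ 2) := by positivity
      simp only [toSphere_infty, toSphere_coe, Matrix.cons_val] at h2
      linarith
    | coe w =>
      have h0 := congrArg (fun v : EuclideanSpace ℝ (Fin 3) => v 0) hpq
      have h1 := congrArg (fun v : EuclideanSpace ℝ (Fin 3) => v 1) hpq
      have h2 := congrArg (fun v : EuclideanSpace ℝ (Fin 3) => v 2) hpq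
      have hz : (1 + ‖z‖ ^ 2) ≠ 0 := by positivity
      have hw : (1 + ‖w‖ ^ 2) ≠ 0 := by positivity
      simp only [toSphere_coe, Matrix.cons_val_zero, Matrix.cons_val_one,
        Matrix.cons_val] at h0 h1 h2
      have h3 : 1 + ‖z‖ ^ 2 = 1 + ‖w‖ ^ 2 := by
        field_simp at h2
        linarith
      rw [h3] at h0 h1
      field_simp at h0 h1
      exact congrArg _ (Complex.ext (by linarith) (by linarith))

theorem continuous_toSphere : Continuous toSphere := by
  rw [OnePoint.continuous_iff]
  have hpos : ∀ z : ℂ, (1 + ‖z‖ ^ 2) ≠ 0 := fun z => by positivity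
  refine ⟨?_, ?_⟩
  · have hn : Tendsto (fun z : ℂ => ‖z‖) (coclosedCompact ℂ) atTop := by
      rw [coclosedCompact_eq_cocompact]
      exact tendsto_norm_cocompact_atTop
    have hb : Tendsto (fun z : ℂ => 2 / ‖z‖) (coclosedCompact ℂ) (𝓝 0) :=
      tendsto_const_nhds.div_atTop hn
    have key : ∀ (z : ℂ) (t : ℝ), |t| ≤ ‖z‖ → ‖2 * t / (1 + ‖z‖ ^ 2)‖ ≤ 2 / ‖z‖ := by
      intro z t ht
      rcases eq_or_ne ‖z‖ 0 with h | h
      · have : t = 0 := abs_nonpos_iff.mp (h ▸ ht)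
        simp [this, h]
      · have hz : 0 < ‖z‖ := lt_of_le_of_ne (norm_nonneg z) h.symm
        rw [Real.norm_eq_abs, abs_div, abs_mul, abs_of_pos (show (0 : ℝ) < 2 by norm_num),
          abs_of_pos (show 0 < 1 + ‖z‖ ^ 2 by positivity), div_le_div_iff₀ (by positivity) hz]
        nlinarith
    have h0 : Tendsto (fun z : ℂ => 2 * z.re / (1 + ‖z‖ ^ 2)) (coclosedCompact ℂ) (𝓝 0) :=
      squeeze_zero_norm (fun z => key z _ (Complex.abs_re_le_norm z)) hb
    have h1 : Tendsto (fun z : ℂ => 2 * z.im / (1 + ‖z‖ ^ 2)) (coclosedCompact ℂ) (𝓝 0) :=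
      squeeze_zero_norm (fun z => key z _ (Complex.abs_im_le_norm z)) hb
    have h2 : Tendsto (fun z : ℂ => 1 - 2 / (1 + ‖z‖ ^ 2)) (coclosedCompact ℂ) (𝓝 1) := by
      have h : Tendsto (fun z : ℂ => 1 + ‖z‖ ^ 2) (coclosedCompact ℂ) atTop :=
        tendsto_atTop_add_const_left _ _ ((tendsto_pow_atTop two_ne_zero).comp hn)
      simpa using (tendsto_const_nhds (x := (1 : ℝ))).sub
        ((tendsto_const_nhds (x := (2 : ℝ))).div_atTop h)
    refine ((PiLp.continuous_toLp 2 (fun _ : Fin 3 => ℝ)).tendsto _).comp ?_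
    rw [tendsto_pi_nhds]
    intro i
    fin_cases i
    · exact h0
    · exact h1
    · exact h2
  · refine (PiLp.continuous_toLp 2 (fun _ : Fin 3 => ℝ)).comp ?_
    refine continuous_pi fun i => ?_
    fin_cases i
    · exact (by fun_prop (disch := exact hpos _) :
        Continuous fun z : ℂ => 2 * z.re / (1 + ‖z‖ ^ 2))
    · exact (by fun_prop (disch := exact hpos _) :
        Continuous fun z : ℂ => 2 * z.im / (1 + ‖z‖ ^ 2))
    · exact (by fun_prop (disch := exact hpos _) :
        Continuous fun z : ℂ => 1 - 2 / (1 + ‖z‖ ^ 2))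

/-- The spherical metric: the distance of two points is the length of the shortest arc of great
circle between their images on the unit sphere. -/
abbrev sphericalMetricAux : MetricSpace (OnePoint ℂ) where
  dist p q := InnerProductGeometry.angle (toSphere p) (toSphere q)
  dist_self p := InnerProductGeometry.angle_self (toSphere_ne_zero p)
  dist_comm p q := InnerProductGeometry.angle_comm _ _
  dist_triangle p q r := InnerProductGeometry.angle_le_angle_add_angle _ _ _
  eq_of_dist_eq_zero {p q} h := by
    obtain ⟨-, r, hr, hq⟩ := InnerProductGeometry.angle_eq_zero_iff.mp h
    have h1 : r = 1 := by
      have := norm_toSphere q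
      rwa [hq, norm_smul, norm_toSphere, mul_one, Real.norm_eq_abs, abs_of_pos hr] at this
    rw [h1, one_smul] at hq
    exact toSphere_injective hq.symm

theorem induced_eq_of_compact {S T : Type*} [t : TopologicalSpace S] [CompactSpace S]
    [MetricSpace T] {f : S → T} (hc : Continuous f) (hf : Function.Injective f) :
    t = TopologicalSpace.induced f inferInstance :=
  (hc.isClosedEmbedding hf).eq_induced

/-- The spherical metric induces the usual topology of `ℂ ∪ {∞}`. -/
theorem topology_eq : (inferInstance : TopologicalSpace (OnePoint ℂ)) =
    sphericalMetricAux.toUniformSpace.toTopologicalSpace := by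
  have hc : @Continuous (OnePoint ℂ) (OnePoint ℂ) inferInstance
      sphericalMetricAux.toUniformSpace.toTopologicalSpace id := by
    refine (@continuous_iff_continuous_dist _ _ sphericalMetricAux.toPseudoMetricSpace _ _).mpr ?_
    rw [continuous_iff_continuousAt]
    intro x
    exact (InnerProductGeometry.continuousAt_angle (x := (toSphere x.1, toSphere x.2))
      (toSphere_ne_zero _) (toSphere_ne_zero _)).comp
      (f := fun x : OnePoint ℂ × OnePoint ℂ => (toSphere x.1, toSphere x.2))
      ((continuous_toSphere.comp continuous_fst).prodMk
        (continuous_toSphere.comp continuous_snd)).continuousAt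
  have he := @induced_eq_of_compact (OnePoint ℂ) (OnePoint ℂ) _ _ sphericalMetricAux id hc
    Function.injective_id
  exact he.trans (@induced_id _ sphericalMetricAux.toUniformSpace.toTopologicalSpace)

/-- The Riemann sphere `ℂ ∪ {∞}` as a metric space, with the spherical metric; its topology is by
construction that of the one-point compactification. This is not an instance, because Mathlib puts
a different extended distance on `OnePoint ℂ`, for which `∞` is at infinite distance. -/
abbrev sphericalMetric : MetricSpace (OnePoint ℂ) :=
  sphericalMetricAux.replaceTopology topology_eq

/-- The Hausdorff distance of two subsets of the Riemann sphere with respect to the spherical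
metric, with values in `[0, ∞]` (the value `∞` occurs only if exactly one of them is empty). -/
def hausdorffEDist (s t : Set (OnePoint ℂ)) : ENNReal :=
  @Metric.hausdorffEDist (OnePoint ℂ)
    sphericalMetric.toPseudoMetricSpace.toPseudoEMetricSpace s t

end RiemannSphere

/-- A continuum in the space `S`: a subset that is compact, connected and nonempty
(`IsConnected` includes nonemptiness). -/
def IsContinuum {S : Type*} [TopologicalSpace S] (X : Set S) : Prop :=
  IsCompact X ∧ IsConnected X

/-- A continuum is decomposable if it is the union of two of its proper subcontinua. -/
def IsDecomposable {S : Type*} [TopologicalSpace S] (X : Set S) : Prop :=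
  ∃ A B : Set S, IsContinuum A ∧ IsContinuum B ∧ A ⊂ X ∧ B ⊂ X ∧ A ∪ B = X

/-- An indecomposable continuum: a continuum that is not decomposable. -/
def IsIndecomposableContinuum {S : Type*} [TopologicalSpace S] (X : Set S) : Prop :=
  IsContinuum X ∧ ¬ IsDecomposable X

/-- `U` is a complementary domain of `X`: a connected component of the complement of `X`. -/
def IsComplementaryDomain {S : Type*} [TopologicalSpace S] (X U : Set S) : Prop :=
  ∃ x ∈ Xᶜ, U = connectedComponentIn Xᶜ x

end

/-!
The proof rests on three facts.

* The sphere is unicoherent (`isUnicoherent_onePoint_complex`), because every continuous map from it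
  to the circle has a continuous logarithm. Hence every complementary domain of a continuum has a
  connected boundary (`IsUnicoherent.isConnected_frontier`).
* Any two points `x ≠ y` of an indecomposable continuum `X` can be approached by a single
  complementary domain: arbitrarily small connected neighbourhoods of `x` and `y` are met by a
  common domain, since otherwise the boundary of a suitable open set would be a continuum in `X`
  that cuts `X` into two proper subcontinua (`IsUnicoherent.exists_domain_inter_nonempty`).
* An indecomposable continuum is irreducible between some two of its points
  (`IsIndecomposableContinuum.exists_irreducible`), by Baire's theorem.

Choose `x` and `y` such that no proper subcontinuum of `X` contains both, and domains `U n` whose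
boundaries meet the `n`-th neighbourhoods of `x` and of `y`. The boundaries are subcontinua of `X`,
so each of their limits in the hyperspace is a subcontinuum of `X` that contains `x` and `y`, that
is, `X` itself. As the hyperspace is compact, the boundaries converge to `X`
(`tendsto_of_irreducible`).
-/

open TopologicalSpace (NonemptyCompacts)

/-! ### Continua and indecomposability -/

section Continua

variable {S : Type*} [TopologicalSpace S]

/-- If two closed sets have a connected union and a connected intersection, then both of them are
connected; here for the first one. -/
theorem IsPreconnected.left_of_union_of_inter {P R : Set S} (hP : IsClosed P) (hR : IsClosed R)
    (hU : IsPreconnected (P ∪ R)) (hI : IsPreconnected (P ∩ R)) : IsPreconnected P := by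
  -- In a separation `E`, `F` of `P`, the piece that contains `P ∩ R` may be enlarged by `R`.
  have key : ∀ E F : Set S, IsClosed E → IsClosed F → P ⊆ E ∪ F → Disjoint E F →
      P ∩ R ⊆ E → P ⊆ E ∨ P ⊆ F := by
    intro E F hE hF hEF hd hsub
    have hd' := Set.disjoint_left.mp hd
    rcases isPreconnected_iff_subset_of_disjoint_closed.mp hU ((P ∩ E) ∪ R) (P ∩ F)
      ((hP.inter hE).union hR) (hP.inter hF)
      (by
        rintro z (hz | hz)
        · rcases hEF hz with h | h
          · exact Or.inl (Or.inl ⟨hz, h⟩)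
          · exact Or.inr ⟨hz, h⟩
        · exact Or.inl (Or.inr hz))
      (by
        ext z
        simp only [mem_inter_iff, mem_union, mem_empty_iff_false, iff_false]
        rintro ⟨-, (⟨-, h⟩ | h), hzP, hzF⟩
        · exact hd' h hzF
        · exact hd' (hsub ⟨hzP, h⟩) hzF) with h | h
    · left
      intro z hz
      rcases h (Or.inl hz) with h' | h'
      · exact h'.2
      · exact hsub ⟨hz, h'⟩
    · right
      exact fun z hz => (h (Or.inl hz)).2
  rw [isPreconnected_iff_subset_of_fully_disjoint_closed hP]
  intro E F hE hF hEF hd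
  rcases isPreconnected_iff_subset_of_disjoint_closed.mp hI E F hE hF
    (inter_subset_left.trans hEF) (by rw [hd.inter_eq, inter_empty]) with h | h
  · exact key E F hE hF hEF hd h
  · exact (key F E hF hE (by rwa [union_comm]) hd.symm h).symm

/-- A continuum is decomposable if it is the union of two proper closed subsets with a connected
intersection: the two subsets are then connected themselves. -/
theorem IsContinuum.isDecomposable_of_union [T2Space S] {X P R : Set S} (hX : IsContinuum X)
    (hP : IsClosed P) (hR : IsClosed R) (hPR : P ∪ R = X) (hI : IsConnected (P ∩ R))
    (hPX : P ≠ X) (hRX : R ≠ X) : IsDecomposable X := by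
  have hPs : P ⊆ X := hPR ▸ subset_union_left
  have hRs : R ⊆ X := hPR ▸ subset_union_right
  have hU : IsPreconnected (P ∪ R) := hPR ▸ hX.2.isPreconnected
  exact ⟨P, R,
    ⟨hX.1.of_isClosed_subset hP hPs, hI.nonempty.mono inter_subset_left,
      IsPreconnected.left_of_union_of_inter hP hR hU hI.isPreconnected⟩,
    ⟨hX.1.of_isClosed_subset hR hRs, hI.nonempty.mono inter_subset_right,
      IsPreconnected.left_of_union_of_inter hR hP (by rwa [union_comm])
        (by rw [inter_comm]; exact hI.isPreconnected)⟩,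
    hPs.ssubset_of_ne hPX, hRs.ssubset_of_ne hRX, hPR⟩

/-- A proper subcontinuum of an indecomposable continuum has empty relative interior. -/
theorem IsIndecomposableContinuum.not_inter_subset [T2Space S] {X D O : Set S}
    (hX : IsIndecomposableContinuum X) (hD : IsContinuum D) (hDX : D ⊂ X) (hO : IsOpen O)
    (hOX : (O ∩ X).Nonempty) : ¬ O ∩ X ⊆ D := by
  intro hOD
  have hDc : IsClosed D := hD.1.isClosed
  have hXc : IsClosed X := hX.1.1.isClosed
  apply hX.2
  by_cases hc : IsPreconnected (X \ D)
  · -- The closure of `X \ D` is a continuum that misses `O`.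
    have hsub : closure (X \ D) ⊆ X := closure_minimal sdiff_subset hXc
    have hO' : closure (X \ D) ⊆ Oᶜ :=
      closure_minimal (fun z hz hzO => hz.2 (hOD ⟨hzO, hz.1⟩)) hO.isClosed_compl
    refine ⟨D, closure (X \ D), hD, ⟨hX.1.1.of_isClosed_subset isClosed_closure hsub,
      (nonempty_of_ssubset hDX).closure, hc.closure⟩, hDX, hsub.ssubset_of_ne ?_, ?_⟩
    · intro h
      obtain ⟨z, hzO, hzX⟩ := hOX
      exact hO' (h.ge hzX) hzO
    · refine Subset.antisymm (union_subset hDX.1 hsub) fun z hz => ?_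
      by_cases hzD : z ∈ D
      · exact Or.inl hzD
      · exact Or.inr (subset_closure ⟨hz, hzD⟩)
  · -- If `X \ D` falls into two pieces, the union of `D` with either piece is a continuum.
    simp only [IsPreconnected, not_forall] at hc
    obtain ⟨u, v, hu, hv, huv, ⟨a, ha, hau⟩, ⟨b, hb, hbv⟩, hn⟩ := hc
    have hdis : ∀ z ∈ X \ D, z ∈ u → z ∉ v := fun z hz h h' => hn ⟨z, hz, h, h'⟩
    refine hX.1.isDecomposable_of_union (P := X ∩ (vᶜ ∪ D)) (R := X ∩ (uᶜ ∪ D))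
      (hXc.inter (hv.isClosed_compl.union hDc)) (hXc.inter (hu.isClosed_compl.union hDc))
      ?_ ?_ ?_ ?_
    · ext z
      have := hdis z
      simp only [mem_union, mem_inter_iff, mem_compl_iff, Set.mem_sdiff] at this ⊢
      tauto
    · convert hD.2 using 1
      ext z
      have h1 := @huv z
      have h2 := @hDX.1 z
      simp only [mem_union, mem_inter_iff, mem_compl_iff, Set.mem_sdiff] at h1 ⊢
      tauto
    · intro h
      rcases (h.ge hb.1).2 with h' | h'
      · exact h' hbv
      · exact hb.2 h'
    · intro h
      rcases (h.ge ha.1).2 with h' | h'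
      · exact h' hau
      · exact ha.2 h'

theorem IsClosed.connectedComponentIn {F : Set S} (hF : IsClosed F) (x : S) :
    IsClosed (connectedComponentIn F x) := by
  by_cases hx : x ∈ F
  · refine isClosed_of_closure_subset ?_
    exact isPreconnected_connectedComponentIn.closure.subset_connectedComponentIn
      (subset_closure (mem_connectedComponentIn hx))
      (closure_minimal (connectedComponentIn_subset F x) hF)
  · rw [connectedComponentIn_eq_empty hx]
    exact isClosed_empty

/-- An indecomposable continuum `X` is irreducible between any given point `x` and a suitable
second point `y`: the proper subcontinua through `x` lie in countably many proper subcontinua, the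
components of `x` in the sets `X \ b` with `b` in a countable base, and these do not cover `X` by
Baire's theorem. -/
theorem IsIndecomposableContinuum.exists_irreducible [T2Space S] [SecondCountableTopology S]
    {X : Set S} (hX : IsIndecomposableContinuum X) {x : S} (hx : x ∈ X) :
    ∃ y ∈ X, ∀ K, IsContinuum K → K ⊆ X → x ∈ K → y ∈ K → K = X := by
  by_contra! hcon
  have hXc : IsClosed X := hX.1.1.isClosed
  let J : Type _ := {b : Set S // b ∈ TopologicalSpace.countableBasis S ∧
    (b ∩ X).Nonempty ∧ x ∉ b}
  have : Countable J :=
    ((TopologicalSpace.countable_countableBasis S).mono fun b hb => hb.1).to_subtype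
  have hbo : ∀ b : J, IsOpen b.1 := fun b => TopologicalSpace.isOpen_of_mem_countableBasis b.2.1
  let D : J → Set S := fun b => connectedComponentIn (X \ b.1) x
  have hDc : ∀ b, IsClosed (D b) := fun b => (hXc.sdiff (hbo b)).connectedComponentIn x
  have hDX : ∀ b, D b ⊆ X \ b.1 := fun b => connectedComponentIn_subset _ _
  have : CompactSpace X := isCompact_iff_compactSpace.mp hX.1.1
  have : Nonempty X := ⟨⟨x, hx⟩⟩
  obtain ⟨b, z, hz⟩ := nonempty_interior_of_iUnion_of_closed
    (f := fun b : J => ((↑) : X → S) ⁻¹' D b)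
    (fun b => (hDc b).preimage continuous_subtype_val) (by
      refine eq_univ_of_forall fun y => ?_
      obtain ⟨K, hK, hKX, hxK, hyK, hne⟩ := hcon y.1 y.2
      obtain ⟨w, hwX, hwK⟩ := nonempty_of_ssubset (hKX.ssubset_of_ne hne)
      have hbasis := TopologicalSpace.isBasis_countableBasis S
      obtain ⟨b, hb, hwb, hbK⟩ := hbasis.exists_subset_of_mem_open
        (show w ∈ Kᶜ from hwK) hK.1.isClosed.isOpen_compl
      have hKD : K ⊆ connectedComponentIn (X \ b) x :=
        hK.2.isPreconnected.subset_connectedComponentIn hxK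
          fun k hk => ⟨hKX hk, fun h => hbK h hk⟩
      exact mem_iUnion.mpr ⟨⟨b, hb, ⟨w, hwb, hwX⟩, fun h => hbK h hxK⟩, hKD hyK⟩)
  obtain ⟨O, hO, hOeq⟩ := isOpen_induced_iff.mp (isOpen_interior (s := ((↑) : X → S) ⁻¹' D b))
  refine hX.not_inter_subset (D := D b) (O := O) ⟨hX.1.1.of_isClosed_subset (hDc b)
    ((hDX b).trans sdiff_subset), isConnected_connectedComponentIn_iff.mpr ⟨hx, b.2.2.2⟩⟩
    ⟨(hDX b).trans sdiff_subset, ?_⟩ hO ⟨z.1, ?_, z.2⟩ ?_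
  · obtain ⟨w, hwb, hwX⟩ := b.2.2.1
    exact fun h => (hDX b (h hwX)).2 hwb
  · exact (hOeq.symm ▸ hz : z ∈ ((↑) : X → S) ⁻¹' O)
  · rintro w ⟨hwO, hwX⟩
    have : (⟨w, hwX⟩ : X) ∈ interior (((↑) : X → S) ⁻¹' D b) := hOeq ▸ hwO
    exact interior_subset (s := ((↑) : X → S) ⁻¹' D b) this

end Continua

/-! ### Limits of continua -/

section Limits

variable {S : Type*} [TopologicalSpace S] [T2Space S]

/-- Connectedness is preserved under limits in the Vietoris topology. -/
theorem isClosed_setOf_isPreconnected :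
    IsClosed {K : NonemptyCompacts S | IsPreconnected (K : Set S)} := by
  rw [← isOpen_compl_iff, isOpen_iff_mem_nhds]
  intro K hK
  have hK' : ¬ IsPreconnected (K : Set S) := hK
  rw [isPreconnected_iff_subset_of_fully_disjoint_closed K.isCompact.isClosed] at hK'
  push Not at hK'
  obtain ⟨E, F, hE, hF, hEF, hd, hnE, hnF⟩ := hK'
  obtain ⟨U, V, hU, hV, hKU, hKV, hUV⟩ := SeparatedNhds.of_isCompact_isCompact
    (K.isCompact.inter_right hE) (K.isCompact.inter_right hF)
    (hd.mono inter_subset_right inter_subset_right)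
  obtain ⟨e, heK, heE⟩ := not_subset.mp hnE
  obtain ⟨f, hfK, hfF⟩ := not_subset.mp hnF
  have heF : e ∈ F := (hEF heK).resolve_left heE
  have hfE : f ∈ E := (hEF hfK).resolve_right hfF
  filter_upwards [(NonemptyCompacts.isOpen_subsets_of_isOpen (hU.union hV)).mem_nhds
      (show (K : Set S) ⊆ U ∪ V from fun z hz => (hEF hz).imp (fun h => hKU ⟨hz, h⟩)
        fun h => hKV ⟨hz, h⟩),
    (NonemptyCompacts.isOpen_inter_nonempty_of_isOpen hU).mem_nhds
      (show ((K : Set S) ∩ U).Nonempty from ⟨f, hfK, hKU ⟨hfK, hfE⟩⟩),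
    (NonemptyCompacts.isOpen_inter_nonempty_of_isOpen hV).mem_nhds
      (show ((K : Set S) ∩ V).Nonempty from ⟨e, heK, hKV ⟨heK, heF⟩⟩)] with L h1 h2 h3 hL
  obtain ⟨z, -, hz1, hz2⟩ := hL U V hU hV h1 h2 h3
  exact disjoint_left.mp hUV hz1 hz2

/-- If the continuum `X` is irreducible between `x` and `y`, then subcontinua of `X` that come
arbitrarily close to both `x` and `y` converge to `X`: every limit of them is a subcontinuum that
contains `x` and `y`. -/
theorem tendsto_of_irreducible [CompactSpace S] {X : NonemptyCompacts S} {x y : S}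
    (hirr : ∀ K, IsContinuum K → K ⊆ (X : Set S) → x ∈ K → y ∈ K → K = X)
    {ι : Type*} {l : Filter ι} {C : ι → NonemptyCompacts S}
    (hC : ∀ i, IsPreconnected (C i : Set S)) (hCX : ∀ i, (C i : Set S) ⊆ X)
    (hx : ∀ N ∈ 𝓝 x, ∀ᶠ i in l, ((C i : Set S) ∩ N).Nonempty)
    (hy : ∀ N ∈ 𝓝 y, ∀ᶠ i in l, ((C i : Set S) ∩ N).Nonempty) :
    Tendsto C l (𝓝 X) := by
  refine le_nhds_of_unique_clusterPt fun L hL => NonemptyCompacts.ext ?_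
  have hcl : ∀ A : Set (NonemptyCompacts S), IsClosed A → (∀ᶠ i in l, C i ∈ A) → L ∈ A :=
    fun A hA h => hA.closure_eq ▸ hL.mem_closure_of_mem _ (mem_map.mpr h)
  have hmem : ∀ p, (∀ N ∈ 𝓝 p, ∀ᶠ i in l, ((C i : Set S) ∩ N).Nonempty) → p ∈ (L : Set S) := by
    intro p hp
    rw [← L.isCompact.isClosed.closure_eq, mem_closure_iff_nhds]
    intro N hN
    obtain ⟨M, hM, hMc, hMN⟩ := exists_mem_nhds_isClosed_subset hN
    exact (hcl _ (NonemptyCompacts.isClosed_inter_nonempty_of_isClosed hMc) (hp M hM)).mono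
      fun z hz => ⟨hMN hz.2, hz.1⟩
  exact hirr L ⟨L.isCompact, L.nonempty, hcl _ isClosed_setOf_isPreconnected (.of_forall hC)⟩
    (hcl _ (NonemptyCompacts.isClosed_subsets_of_isClosed X.isCompact.isClosed) (.of_forall hCX))
    (hmem x hx) (hmem y hy)

end Limits

/-! ### Complementary domains in unicoherent spaces -/

/-- A space is unicoherent if any two closed connected sets that cover it have a connected
intersection. The empty set counts as connected here, and the space itself is not required to be
connected. -/
def IsUnicoherent (S : Type*) [TopologicalSpace S] : Prop :=
  ∀ A B : Set S, IsClosed A → IsClosed B → IsPreconnected A → IsPreconnected B → A ∪ B = univ →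
    IsPreconnected (A ∩ B)

section Domains

variable {S : Type*} [TopologicalSpace S]

theorem connectedComponentIn_eq_of_inter_nonempty {F : Set S} {x y : S}
    (h : (connectedComponentIn F x ∩ connectedComponentIn F y).Nonempty) :
    connectedComponentIn F x = connectedComponentIn F y := by
  obtain ⟨z, hzx, hzy⟩ := h
  rw [connectedComponentIn_eq hzx, connectedComponentIn_eq hzy]

theorem frontier_connectedComponentIn_compl_subset [LocallyConnectedSpace S] {K : Set S}
    (hK : IsClosed K) (x : S) :
    frontier (connectedComponentIn Kᶜ x) ⊆ K := by
  intro z hz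
  by_contra hzK
  have hW : IsOpen (connectedComponentIn Kᶜ z) := hK.isOpen_compl.connectedComponentIn
  have hU : IsOpen (connectedComponentIn Kᶜ x) := hK.isOpen_compl.connectedComponentIn
  have hzW : z ∈ connectedComponentIn Kᶜ z := mem_connectedComponentIn hzK
  have heq := connectedComponentIn_eq_of_inter_nonempty
    (mem_closure_iff.mp hz.1 _ hW hzW)
  rw [hU.frontier_eq] at hz
  exact hz.2 (heq ▸ hzW)

theorem nonempty_frontier_connectedComponentIn_compl [PreconnectedSpace S] {K : Set S}
    (hK : K.Nonempty) {x : S} (hx : x ∈ Kᶜ) :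
    (frontier (connectedComponentIn Kᶜ x)).Nonempty := by
  refine nonempty_frontier_iff.mpr ⟨⟨x, mem_connectedComponentIn hx⟩, fun h => ?_⟩
  obtain ⟨k, hk⟩ := hK
  exact connectedComponentIn_subset Kᶜ x (h ▸ mem_univ k) hk

/-- The complement of a complementary domain of a continuum is connected: it is the union of the
continuum and the closures of the other domains, each of which meets the continuum. -/
theorem isPreconnected_compl_connectedComponentIn_compl [LocallyConnectedSpace S]
    [PreconnectedSpace S] {K : Set S}
    (hK : IsClosed K) (hKc : IsConnected K) (x : S) :
    IsPreconnected (connectedComponentIn Kᶜ x)ᶜ := by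
  have hKU : K ⊆ (connectedComponentIn Kᶜ x)ᶜ := fun k hk h => connectedComponentIn_subset _ _ h hk
  obtain ⟨k, hk⟩ := hKc.nonempty
  refine isPreconnected_of_forall k fun y hy => ?_
  by_cases hyK : y ∈ K
  · exact ⟨K, hKU, hk, hyK, hKc.isPreconnected⟩
  -- The closure of the component of `y` meets `K` and so connects `y` to `K`.
  have hyW : y ∈ connectedComponentIn Kᶜ y := mem_connectedComponentIn hyK
  obtain ⟨w, hw⟩ := nonempty_frontier_connectedComponentIn_compl ⟨k, hk⟩ hyK
  refine ⟨K ∪ closure (connectedComponentIn Kᶜ y), union_subset hKU ?_, Or.inl hk,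
    Or.inr (subset_closure hyW), hKc.isPreconnected.union w
      (frontier_connectedComponentIn_compl_subset hK y hw) (frontier_subset_closure hw)
      isPreconnected_connectedComponentIn.closure⟩
  refine closure_minimal (fun z hz hzx => hy ?_)
    hK.isOpen_compl.connectedComponentIn.isClosed_compl
  exact connectedComponentIn_eq_of_inter_nonempty ⟨z, hzx, hz⟩ ▸ hyW

/-- In a unicoherent space, the complementary domains of a continuum have connected boundaries. -/
theorem IsUnicoherent.isConnected_frontier [LocallyConnectedSpace S] [PreconnectedSpace S]
    (hS : IsUnicoherent S) {K : Set S}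
    (hK : IsClosed K) (hKc : IsConnected K) {x : S} (hx : x ∈ Kᶜ) :
    IsConnected (frontier (connectedComponentIn Kᶜ x)) := by
  have hU : IsOpen (connectedComponentIn Kᶜ x) := hK.isOpen_compl.connectedComponentIn
  refine ⟨nonempty_frontier_connectedComponentIn_compl hKc.nonempty hx, ?_⟩
  rw [hU.frontier_eq, sdiff_eq]
  exact hS _ _ isClosed_closure hU.isClosed_compl isPreconnected_connectedComponentIn.closure
    (isPreconnected_compl_connectedComponentIn_compl hK hKc x)
    (eq_univ_of_forall fun z => (em (z ∈ connectedComponentIn Kᶜ x)).imp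
      (fun h => subset_closure h) id)

/-- Two disjoint connected open sets that meet an indecomposable continuum `X` are met by a common
complementary domain of `X`. Otherwise the union `G` of `V₁` and the domains that meet it is
disjoint from `V₂`. Let `Q` be the component of the complement of `closure G` that contains a
point of `V₂ ∩ X`. Its boundary is a continuum contained in `X`, and it separates `X` into the two
proper subcontinua `X ∩ closure Q` and `X \ Q`. -/
theorem IsUnicoherent.exists_domain_inter_nonempty [LocallyConnectedSpace S]
    [PreconnectedSpace S] [T2Space S]
    (hS : IsUnicoherent S) {X : Set S} (hX : IsIndecomposableContinuum X) {V₁ V₂ : Set S}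
    (hV₁ : IsOpen V₁) (hV₂ : IsOpen V₂) (hc₁ : IsPreconnected V₁) (hd : Disjoint V₁ V₂)
    (hX₁ : (V₁ ∩ X).Nonempty) (hX₂ : (V₂ ∩ X).Nonempty) :
    ∃ z ∈ Xᶜ, (connectedComponentIn Xᶜ z ∩ V₁).Nonempty ∧
      (connectedComponentIn Xᶜ z ∩ V₂).Nonempty := by
  by_contra! hcon
  have hXc : IsClosed X := hX.1.1.isClosed
  have hco : ∀ z, IsOpen (connectedComponentIn Xᶜ z) :=
    fun z => hXc.isOpen_compl.connectedComponentIn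
  obtain ⟨a, haV, haX⟩ := hX₁
  obtain ⟨b, hbV, hbX⟩ := hX₂
  let I : Set S := {z | z ∈ Xᶜ ∧ (connectedComponentIn Xᶜ z ∩ V₁).Nonempty}
  let G : Set S := V₁ ∪ ⋃ z ∈ I, connectedComponentIn Xᶜ z
  have hGo : IsOpen G := hV₁.union (isOpen_biUnion fun z _ => hco z)
  have haG : a ∈ G := Or.inl haV
  have hGc : IsPreconnected G := by
    refine isPreconnected_of_forall a fun y hy => ?_
    rcases hy with hy | hy
    · exact ⟨V₁, subset_union_left, haV, hy, hc₁⟩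
    · obtain ⟨z, hz, hyz⟩ := mem_iUnion₂.mp hy
      refine ⟨V₁ ∪ connectedComponentIn Xᶜ z, union_subset_union_right _
        (subset_biUnion_of_mem (u := fun z => connectedComponentIn Xᶜ z) hz), Or.inl haV,
        Or.inr hyz, hc₁.union' ?_ isPreconnected_connectedComponentIn⟩
      rw [inter_comm]
      exact hz.2
  have hGV : G ⊆ V₂ᶜ := by
    refine union_subset hd.subset_compl_right (iUnion₂_subset fun z hz w hw hwV => ?_)
    exact (hcon z hz.1 hz.2 ▸ ⟨hw, hwV⟩ : w ∈ (∅ : Set S))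
  have hb : b ∈ (closure G)ᶜ := fun h => closure_minimal hGV hV₂.isClosed_compl h hbV
  have hGcl : IsConnected (closure G) := ⟨⟨a, subset_closure haG⟩, hGc.closure⟩
  set Q := connectedComponentIn (closure G)ᶜ b with hQ
  have hQo : IsOpen Q := isClosed_closure.isOpen_compl.connectedComponentIn
  have hQG : closure Q ⊆ Gᶜ := closure_minimal
    (fun w hw h => connectedComponentIn_subset _ _ hw (subset_closure h)) hGo.isClosed_compl
  have hFX : frontier Q ⊆ X := by
    intro z hz
    have hzG : z ∈ closure G := frontier_connectedComponentIn_compl_subset isClosed_closure b hz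
    by_contra hzX
    have hzz : z ∈ connectedComponentIn Xᶜ z := mem_connectedComponentIn hzX
    refine hQG hz.1 (Or.inr (mem_iUnion₂.mpr ?_))
    obtain ⟨w, hwz, hw | hw⟩ := mem_closure_iff.mp hzG _ (hco z) hzz
    · exact ⟨z, ⟨hzX, w, hwz, hw⟩, hzz⟩
    · obtain ⟨t, ht, hwt⟩ := mem_iUnion₂.mp hw
      exact ⟨t, ht, connectedComponentIn_eq_of_inter_nonempty ⟨w, hwz, hwt⟩ ▸ hzz⟩
  refine hX.2 (hX.1.isDecomposable_of_union (P := X ∩ closure Q) (R := X ∩ Qᶜ)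
    (hXc.inter isClosed_closure) (hXc.inter hQo.isClosed_compl) ?_ ?_ ?_ ?_)
  · rw [← inter_union_distrib_left, inter_eq_left]
    exact fun z _ => (em (z ∈ Q)).imp (fun h => subset_closure h) id
  · rw [← inter_inter_distrib_left, ← sdiff_eq, ← hQo.frontier_eq, inter_eq_right.mpr hFX]
    exact hS.isConnected_frontier isClosed_closure hGcl hb
  · exact fun h => hQG (h.ge haX).2 haG
  · exact fun h => (h.ge hbX).2 (mem_connectedComponentIn hb)

theorem inter_frontier_nonempty_of_isPreconnected {V U : Set S}
    (hVc : IsPreconnected V) (hU : IsOpen U) (hVU : (U ∩ V).Nonempty) (hn : ¬ V ⊆ U) :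
    (frontier U ∩ V).Nonempty := by
  by_contra! h
  obtain ⟨p, hpV, hpU⟩ := not_subset.mp hn
  have hsub : V ⊆ U ∪ (closure U)ᶜ := by
    intro z hz
    by_contra hzU
    simp only [mem_union, mem_compl_iff, not_or, not_not] at hzU
    have : z ∈ frontier U ∩ V := ⟨hU.frontier_eq ▸ ⟨hzU.2, hzU.1⟩, hz⟩
    rwa [h] at this
  obtain ⟨z, -, hz, hz'⟩ := hVc U (closure U)ᶜ hU isClosed_closure.isOpen_compl hsub
    (by rwa [inter_comm]) ⟨p, hpV, (hsub hpV).resolve_left hpU⟩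
  exact hz' (subset_closure hz)

/-- Given neighbourhoods of two points of an indecomposable continuum, some complementary domain has
a boundary that meets both. The two points may coincide only if the continuum is a single point. -/
theorem IsUnicoherent.exists_domain_frontier_inter_nonempty [LocallyConnectedSpace S]
    [PreconnectedSpace S] [T2Space S] [Nontrivial S] (hS : IsUnicoherent S) {X : Set S}
    (hX : IsIndecomposableContinuum X) {x y : S}
    (hx : x ∈ X) (hy : y ∈ X) {M N : Set S} (hM : M ∈ 𝓝 x) (hN : N ∈ 𝓝 y)
    (hxy : x = y → X = {x}) :
    ∃ z ∈ Xᶜ, (frontier (connectedComponentIn Xᶜ z) ∩ M).Nonempty ∧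
      (frontier (connectedComponentIn Xᶜ z) ∩ N).Nonempty := by
  have hXc : IsClosed X := hX.1.1.isClosed
  rcases eq_or_ne x y with rfl | hne
  · obtain ⟨z, hz⟩ := exists_ne x
    have hzX : z ∈ Xᶜ := by rw [hxy rfl]; exact hz
    obtain ⟨w, hw⟩ := nonempty_frontier_connectedComponentIn_compl ⟨x, hx⟩ hzX
    have hwX := frontier_connectedComponentIn_compl_subset hXc z hw
    obtain rfl : w = x := by rwa [hxy rfl] at hwX
    exact ⟨z, hzX, ⟨w, hw, mem_of_mem_nhds hM⟩, ⟨w, hw, mem_of_mem_nhds hN⟩⟩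
  · obtain ⟨u, v, hu, hv, hxu, hyv, huv⟩ := t2_separation hne
    obtain ⟨V₁, ⟨hV₁, hxV, hc₁⟩, hs₁⟩ := (LocallyConnectedSpace.open_connected_basis x).mem_iff.mp
      (Filter.inter_mem hM (hu.mem_nhds hxu))
    obtain ⟨V₂, ⟨hV₂, hyV, hc₂⟩, hs₂⟩ := (LocallyConnectedSpace.open_connected_basis y).mem_iff.mp
      (Filter.inter_mem hN (hv.mem_nhds hyv))
    obtain ⟨z, hz, h₁, h₂⟩ := hS.exists_domain_inter_nonempty hX hV₁ hV₂ hc₁.isPreconnected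
      (huv.mono (fun w hw => (hs₁ hw).2) fun w hw => (hs₂ hw).2) ⟨x, hxV, hx⟩ ⟨y, hyV, hy⟩
    have hU : IsOpen (connectedComponentIn Xᶜ z) := hXc.isOpen_compl.connectedComponentIn
    refine ⟨z, hz, ?_, ?_⟩
    · exact (inter_frontier_nonempty_of_isPreconnected hc₁.isPreconnected hU h₁
        fun h => connectedComponentIn_subset _ _ (h hxV) hx).mono
        (inter_subset_inter_right _ fun w hw => (hs₁ hw).1)
    · exact (inter_frontier_nonempty_of_isPreconnected hc₂.isPreconnected hU h₂
        fun h => connectedComponentIn_subset _ _ (h hyV) hy).mono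
        (inter_subset_inter_right _ fun w hw => (hs₂ hw).1)

/-- The frontiers of suitable complementary domains of an indecomposable continuum `X` converge
to `X` in the Vietoris topology. -/
theorem IsUnicoherent.exists_tendsto_frontier [LocallyConnectedSpace S]
    [PreconnectedSpace S] [T2Space S] [CompactSpace S] [SecondCountableTopology S] [Nontrivial S]
    (hS : IsUnicoherent S) {X : NonemptyCompacts S}
    (hX : IsIndecomposableContinuum (X : Set S)) :
    ∃ (U : ℕ → Set S) (C : ℕ → NonemptyCompacts S),
      (∀ n, IsComplementaryDomain (X : Set S) (U n)) ∧ (∀ n, (C n : Set S) = frontier (U n)) ∧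
        Tendsto C atTop (𝓝 X) := by
  obtain ⟨x, hx⟩ := X.nonempty
  obtain ⟨y, hy, hirr⟩ := hX.exists_irreducible hx
  have hxy : x = y → (X : Set S) = {x} := fun h =>
    (hirr {x} ⟨isCompact_singleton, isConnected_singleton⟩ (singleton_subset_iff.mpr hx) rfl
      h.symm).symm
  obtain ⟨M, hM⟩ := (𝓝 x).exists_antitone_basis
  obtain ⟨N, hN⟩ := (𝓝 y).exists_antitone_basis
  choose z hz h₁ h₂ using fun n => hS.exists_domain_frontier_inter_nonempty hX hx hy
    (hM.mem n) (hN.mem n) hxy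
  have hXc : IsClosed (X : Set S) := X.isCompact.isClosed
  refine ⟨fun n => connectedComponentIn (X : Set S)ᶜ (z n),
    fun n => ⟨⟨frontier (connectedComponentIn (X : Set S)ᶜ (z n)), isClosed_frontier.isCompact⟩,
      (h₁ n).mono inter_subset_left⟩, fun n => ⟨z n, hz n, rfl⟩, fun n => rfl, ?_⟩
  refine tendsto_of_irreducible hirr
    (fun n => (hS.isConnected_frontier hXc hX.1.2 (hz n)).isPreconnected)
    (fun n => frontier_connectedComponentIn_compl_subset hXc (z n)) ?_ ?_
  · intro A hA
    filter_upwards [hM.eventually_subset hA] with n hn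
    exact (h₁ n).mono (inter_subset_inter_right _ hn)
  · intro A hA
    filter_upwards [hN.eventually_subset hA] with n hn
    exact (h₂ n).mono (inter_subset_inter_right _ hn)

end Domains

/-! ### Unicoherence of the sphere -/

/-- Two continuous logarithms of the same circle-valued map differ by a constant on a connected
set. -/
theorem Circle.exists_int_of_exp_eq_exp {T : Type*} [TopologicalSpace T] {s : Set T}
    (hs : IsPreconnected s) {f g : T → ℝ} (hf : ContinuousOn f s) (hg : ContinuousOn g s)
    (h : ∀ x ∈ s, Circle.exp (f x) = Circle.exp (g x)) :
    ∃ m : ℤ, ∀ x ∈ s, f x = g x + m * (2 * Real.pi) := by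
  rcases s.eq_empty_or_nonempty with rfl | ⟨a, ha⟩
  · exact ⟨0, by simp⟩
  obtain ⟨m, hm⟩ := Circle.exp_eq_exp.mp (h a ha)
  refine ⟨m, Circle.isCoveringMap_exp.eqOn_of_comp_eqOn hs hf
    (g₂ := fun x => g x + m * (2 * Real.pi)) (hg.add continuousOn_const) (fun x hx => ?_) ha hm⟩
  exact (h x hx).trans (Circle.exp_eq_exp.mpr ⟨-m, by push_cast; ring⟩)

/-- A normal space on which every continuous map to the circle has a continuous logarithm is
unicoherent. If `A ∩ B` were the disjoint union of nonempty closed sets `E` and `F`, let `u` be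
`0` on `E` and `1` on `F`. The map `exp (iπu)` on `A`, `exp (-iπu)` on `B` has a logarithm, which
differs from `πu` by a constant on `A` and from `-πu` by a constant on `B`; comparison on `E` and
on `F` gives a contradiction. -/
theorem isUnicoherent_of_exists_lift {S : Type*} [TopologicalSpace S] [NormalSpace S]
    (hS : ∀ g : C(S, Circle), ∃ h : C(S, ℝ), ∀ p, Circle.exp (h p) = g p) :
    IsUnicoherent S := by
  classical
  intro A B hA hB hAc hBc hAB
  rw [isPreconnected_iff_subset_of_fully_disjoint_closed (hA.inter hB)]
  intro E F hE hF hsub hd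
  by_contra! hcon
  obtain ⟨q, hq, hqE⟩ := not_subset.mp hcon.1
  obtain ⟨p, hp, hpF⟩ := not_subset.mp hcon.2
  have hpE := (hsub hp).resolve_right hpF
  have hqF := (hsub hq).resolve_left hqE
  obtain ⟨u, huE, huF, -⟩ := exists_continuous_zero_one_of_isClosed hE hF hd
  have hg : Continuous fun z => if z ∈ A then Circle.exp (Real.pi * u z)
      else Circle.exp (-(Real.pi * u z)) := by
    refine Continuous.if (p := fun z => z ∈ A) (fun z hz => ?_)
      (Circle.exp.continuous.comp (by fun_prop)) (Circle.exp.continuous.comp (by fun_prop))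
    have hz' : z ∈ A ∩ B := by
      refine ⟨hA.frontier_subset hz, ?_⟩
      have h1 : z ∈ closure Aᶜ := (frontier_eq_closure_inter_closure (s := A) ▸ hz).2
      refine closure_minimal (fun w hw => ?_) hB h1
      exact ((hAB ▸ mem_univ w : w ∈ A ∪ B)).resolve_left hw
    rcases hsub hz' with h | h
    · simp [huE h]
    · rw [huF h]
      exact Circle.exp_eq_exp.mpr ⟨1, by simp; ring⟩
  obtain ⟨h, hh⟩ := hS ⟨_, hg⟩
  obtain ⟨m, hm⟩ := Circle.exists_int_of_exp_eq_exp hAc (f := h) (g := fun z => Real.pi * u z)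
    h.continuous.continuousOn (by fun_prop) fun z hz => by simp [hh, hz]
  obtain ⟨n, hn⟩ := Circle.exists_int_of_exp_eq_exp hBc (f := h) (g := fun z => -(Real.pi * u z))
    h.continuous.continuousOn (by fun_prop) fun z hz => by
      by_cases hzA : z ∈ A
      · rcases hsub ⟨hzA, hz⟩ with h' | h'
        · simp [hh, hzA, huE h']
        · simp only [hh, ContinuousMap.coe_mk, hzA, if_true]
          rw [huF h']
          exact Circle.exp_eq_exp.mpr ⟨1, by simp; ring⟩
      · simp [hh, hzA]
  have e1 := (hm p hp.1).symm.trans (hn p hp.2)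
  have e2 := (hm q hq.1).symm.trans (hn q hq.2)
  simp only [huE hpE, huF hqF, Pi.zero_apply, Pi.one_apply] at e1 e2
  have hpi := Real.pi_pos
  have e3 : (m : ℝ) = n := by
    have : (m - n : ℝ) * (2 * Real.pi) = 0 := by linarith
    rcases mul_eq_zero.mp this with h0 | h0
    · linarith
    · linarith
  rw [e3] at e2
  linarith

theorem isPreconnected_setOf_lt_norm {R : ℝ} (hR : 0 < R) :
    IsPreconnected {z : ℂ | R < ‖z‖} := by
  have h : {z : ℂ | R < ‖z‖} = Complex.exp '' {w : ℂ | Real.log R < w.re} := by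
    ext z
    constructor
    · intro hz
      have hz0 : z ≠ 0 := norm_pos_iff.mp (hR.trans hz)
      exact ⟨Complex.log z, by
        simpa [Complex.log_re] using Real.log_lt_log hR hz, Complex.exp_log hz0⟩
    · rintro ⟨w, hw, rfl⟩
      simpa [Complex.norm_exp] using (Real.log_lt_iff_lt_exp hR).mp hw
  rw [h]
  exact (convex_halfSpace_re_gt _).isPreconnected.image _ Complex.continuous_exp.continuousOn

/-- Every continuous map from the Riemann sphere to the circle has a continuous logarithm: one
exists on the simply connected plane, and near `∞` it differs by a constant from one that is
defined in a neighbourhood of `∞`. -/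
theorem OnePoint.exists_lift_circle (g : C(OnePoint ℂ, Circle)) :
    ∃ h : C(OnePoint ℂ, ℝ), ∀ p, Circle.exp (h p) = g p := by
  obtain ⟨h, ⟨-, hh⟩, -⟩ := Circle.isCoveringMap_exp.existsUnique_continuousMap_lifts
    (⟨fun z : ℂ => g z, g.continuous.comp OnePoint.continuous_coe⟩ : C(ℂ, Circle)) 0
    (Complex.arg (g (0 : ℂ))) (Circle.exp_arg _)
  have hh' : ∀ z : ℂ, Circle.exp (h z) = g z := fun z => congrFun hh z
  let θ : ℝ := Complex.arg (g OnePoint.infty)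
  let s : OnePoint ℂ → ℝ := fun p => Complex.arg (g p / g OnePoint.infty : Circle) + θ
  have hs : ∀ p, Circle.exp (s p) = g p := fun p => by
    rw [Circle.exp_add, Circle.exp_arg, Circle.exp_arg, div_mul_cancel]
  let N : Set (OnePoint ℂ) := {p | ((g p / g OnePoint.infty : Circle) : ℂ) ∈ Complex.slitPlane}
  have hgc : Continuous fun p => ((g p / g OnePoint.infty : Circle) : ℂ) := by fun_prop
  have hsN : ∀ p ∈ N, ContinuousAt s p := fun p hp =>
    (ContinuousAt.comp (f := fun p => ((g p / g OnePoint.infty : Circle) : ℂ))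
      (Complex.continuousAt_arg hp) hgc.continuousAt).add_const θ
  have hNo : IsOpen N := Complex.isOpen_slitPlane.preimage hgc
  have hN : OnePoint.infty ∈ N := by simp [N]
  have hev : ∀ᶠ z : ℂ in Bornology.cobounded ℂ, (z : OnePoint ℂ) ∈ N := by
    rw [Metric.cobounded_eq_cocompact, ← coclosedCompact_eq_cocompact]
    exact OnePoint.tendsto_coe_infty.eventually (hNo.mem_nhds hN)
  obtain ⟨R, -, hR⟩ := (Filter.hasBasis_cobounded_norm (E := ℂ)).eventually_iff.mp hev
  have hR' : ∀ z : ℂ, max R 1 < ‖z‖ → (z : OnePoint ℂ) ∈ N :=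
    fun z hz => hR ((le_max_left _ _).trans hz.le)
  obtain ⟨m, hm⟩ := Circle.exists_int_of_exp_eq_exp
    (isPreconnected_setOf_lt_norm (lt_max_of_lt_right one_pos : 0 < max R 1)) (f := h)
    (g := fun z => s z) h.continuous.continuousOn
    (fun z hz => ((hsN z (hR' z hz)).comp OnePoint.continuous_coe.continuousAt).continuousWithinAt)
    (fun z _ => (hh' z).trans (hs z).symm)
  let H : OnePoint ℂ → ℝ := fun p => p.elim (s OnePoint.infty + m * (2 * Real.pi)) h
  refine ⟨⟨H, OnePoint.continuous_iff _ |>.mpr ⟨?_, h.continuous⟩⟩, fun p => ?_⟩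
  · have ht : Tendsto (fun z : ℂ => s z + m * (2 * Real.pi)) (coclosedCompact ℂ)
        (𝓝 (s OnePoint.infty + m * (2 * Real.pi))) :=
      ((hsN _ hN).tendsto.comp OnePoint.tendsto_coe_infty).add tendsto_const_nhds
    refine ht.congr' ?_
    rw [coclosedCompact_eq_cocompact, ← Metric.cobounded_eq_cocompact]
    filter_upwards [tendsto_norm_cobounded_atTop.eventually_gt_atTop (max R 1)] with z hz
    exact (hm z hz).symm
  · induction p using OnePoint.rec with
    | infty =>
      exact (Circle.exp_eq_exp.mpr ⟨m, rfl⟩).trans (hs OnePoint.infty)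
    | coe z => exact hh' z

theorem isUnicoherent_onePoint_complex : IsUnicoherent (OnePoint ℂ) :=
  isUnicoherent_of_exists_lift OnePoint.exists_lift_circle

/-- The Riemann sphere is homeomorphic to the unit sphere of Euclidean three-space. -/
noncomputable def onePointComplexHomeoSphere :
    OnePoint ℂ ≃ₜ Metric.sphere (0 : EuclideanSpace ℝ (Fin 3)) 1 :=
  onePointEquivSphereOfFinrankEq (by simp [Complex.finrank_real_complex])

instance : LocallyConnectedSpace (OnePoint ℂ) :=
  have : Fact (Module.finrank ℝ (EuclideanSpace ℝ (Fin 3)) = 2 + 1) := ⟨by simp⟩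
  have := ChartedSpace.locallyConnectedSpace (EuclideanSpace ℝ (Fin 2))
    (Metric.sphere (0 : EuclideanSpace ℝ (Fin 3)) 1)
  onePointComplexHomeoSphere.locallyConnectedSpace

instance : SecondCountableTopology (OnePoint ℂ) :=
  onePointComplexHomeoSphere.isEmbedding.secondCountableTopology

/-- The Vietoris topology on nonempty compact sets is the topology of the Hausdorff distance. -/
theorem RiemannSphere.tendsto_hausdorffEDist {ι : Type*} {l : Filter ι}
    {C : ι → NonemptyCompacts (OnePoint ℂ)} {X : NonemptyCompacts (OnePoint ℂ)}
    (h : Tendsto C l (𝓝 X)) :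
    Tendsto (fun i => RiemannSphere.hausdorffEDist (C i) X) l (𝓝 0) := by
  let _ := RiemannSphere.sphericalMetric
  exact tendsto_iff_edist_tendsto_0.mp h

theorem theorem2p9 (X : Set (OnePoint ℂ)) (hX : IsIndecomposableContinuum X) :
    ∃ U : ℕ → Set (OnePoint ℂ), (∀ n, IsComplementaryDomain X (U n)) ∧
      Tendsto (fun n => RiemannSphere.hausdorffEDist (frontier (U n)) X) atTop (𝓝 0) := by
  obtain ⟨U, C, hU, hC, hlim⟩ := isUnicoherent_onePoint_complex.exists_tendsto_frontier
    (X := ⟨⟨X, hX.1.1⟩, hX.1.2.nonempty⟩) hX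
  refine ⟨U, hU, ?_⟩
  have h := RiemannSphere.tendsto_hausdorffEDist hlim
  simp only [hC] at h
  exact h
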